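/- Conventions. Computability of partial maps $\mathbb{N}^{\mathbb N}\to\mathbb{N}^{\mathbb N}$ is Type-2 computability. A multivalued operation $f:\subseteq S\rightrightarrows T$ between sets with representations $\delta,\delta'$ is $(\delta;\delta')$-computable if some computable partial map $G$ on $\mathbb{N}^{\mathbb N}$ sends every $\delta$-name of every $x\in\operatorname{dom} f$ to a $\delta'$-name of some element of $f(x)$. Tuples $\langle\cdot,\dots,\cdot\rangle$ in $\mathbb{N}^{\mathbb N}$, product representations $[\delta,\delta']$ and sequence representations $\delta^\omega$ are the standard ones; a $\delta\sqcap\delta'$-name of $x$ consists of a $\delta$-name and a $\delta'$-name of $x$. Let $(X,d,\nu)$ be a computable metric space: $d$ is a metric on $X$, $\nu:\mathbb N\to X$ has dense image and $(i,j)\mapsto d(\nu(i),\nu(j))$ is computable. Let $\delta_X$ be its Cauchy representation, $\alpha\langle a,r\rangle=B(\nu(a),\nu_{\mathbb{Q}^+}(r))$ the standard numbering of ideal balls, $\alpha'(0)=\emptyset$, $\alpha'(n+1)=\alpha(n)$. The following representations of hyperspaces are used. * $p$ is a $\delta_{\Sigma^0_1(X)}$-name of an open $U$ if $U=\bigcup_i\alpha'(p_i)$,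 and a $\delta_{\Pi^0_1(X)}$-name of a closed $A$ if it is a $\delta_{\Sigma^0_1(X)}$-name of $X\setminus A$. * A $\delta_{\rm range}$-name of a closed $A\ne\emptyset$ is a sequence of $\delta_X$-names, with all entries increased by $1$, of points of $A$ that are dense in $A$; $\emptyset$ has the zero sequence as its name. * $p$ is a $\delta^{>}_{\rm dist}$-name of a closed $A$ if $\eta_p$ maps every $\delta_X$-name of every $x\in X$ to an enumeration of $\{q\in\mathbb Q: q<d(x,A)\}$, where $d(x,\emptyset)=\infty$ and $\eta$ is the standard representation of the continuous partial maps $\mathbb{N}^{\mathbb N}\to\mathbb{N}^{\mathbb N}$ with $G_\delta$ domain. A *Dugundji system* in a metric space $Z$ for a nonempty closed $B\subseteq Z$ is a pair $((V_i)_{i\in\mathbb N},(y_i)_{i\in\mathbb N})$ of a sequence of open subsets of $Z$, locally finite in its union (each point of $\bigcup_iV_i$ has a neighbourhood that meets only finitely many $V_j$), and a sequence of points of $Z$ such that 1. $\bigcup_iV_i=Z\setminus B$, and $y_i\in B$ for all $i$; 2. $d(x,y_i)\le 2\,d(x,B)$ for all $i$ and all $x\in V_i$; 3. if $(n_i)_i\subseteq\mathbb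 N$ satisfies $\lim_i d(V_{n_i},B)=0$ then $\lim_i\operatorname{diam}V_{n_i}=0$ (where $d(\emptyset,B)=\infty$). For closed $A\subseteq X$ and $\emptyset\neq B\subseteq A$ closed, a *Dugundji system for $B$ relative to $A$* is a pair $((V_i)_i,(y_i)_i)$ with $V_i$ open in $X$ and $y_i\in X$ such that $((V_i\cap A)_i,(y_i)_i)$ is a Dugundji system for $B$ in the metric space $A$. Let $\mathcal Y$ be a class of nonempty closed subsets of $X$ with a representation $\delta_{\mathcal Y}$ such that $\delta_{\mathcal Y}\le\delta_{\Pi^0_1(X)}|^{\mathcal Y}$ (names can be computably translated). Put $$F=\{(A,B): A\in\mathcal Y,\ B\subseteq X\text{ closed},\ \emptyset\ne B\subseteq A\},\qquad \delta_5=[\delta_{\mathcal Y},\delta_{\rm range}\sqcap\delta_{\rm dist}^{>}]|^F,$$ and let $E$ be the set of all $(A;(V_i)_i,(y_i)_i)$ such that $A\in\mathcal Y$ and $((V_i)_i,(y_i)_i)$ is a Dugundji system relative to $A$ (for $A\setminus\bigcup_iV_i$). A $\delta_6$-name of $(A;(V_i)_i,(y_i)_i)\in E$ is a tuple $\langle p,\tilde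 p,\langle\tilde q,r,s\rangle,t\rangle$ such that $p$ is a $\delta_{\mathcal Y}$-name of $A$; $\tilde p$ is a $\delta^\omega_{\Sigma^0_1(X)}$-name of $(V_i)_i$; $\tilde q$ is a name of $(V_i\cap A)_i$ as a sequence of open subsets of $A$ with respect to the basis numbering $a\mapsto\alpha(a)\cap A$; $\bigcup_i(V_i\cap A)=\bigcup_i(\alpha'(r_i)\cap A)$; for each $i$, $s_i$ is the canonical code of a finite set containing every $j$ with $V_j\cap A\cap\alpha'(r_i)\neq\emptyset$; and $t$ is a $\delta_X^\omega$-name of $(y_i)_i$. **Proposition.** Suppose that the (everywhere defined, multivalued) operation $\tilde S:\Sigma^0_1(X)^{\mathbb N}\times\mathcal Y\rightrightarrows\Sigma^0_1(X)^{\mathbb N}$, $$\tilde S((V_i)_i,Y)=\Bigl\{(W_i)_i:\ (\forall i)\,W_i\subseteq V_i,\ \ \bigcup_iW_i\cap Y=\bigcup_iV_i\cap Y,\ \ (\forall i\ne j)\,W_i\cap W_j=\emptyset\Bigr\},$$ is $([\delta_{\Sigma^0_1(X)}^\omega,\delta_{\mathcal Y}];\delta_{\Sigma^0_1(X)}^\omega)$-computable.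 Then the operation $R':\subseteq F\rightrightarrows E$ with domain $\{(A,B)\in F: B\ne X\}$ and $$R'(A,B)=\Bigl\{(A;(W_i)_i,(y_i)_i)\in E:\ A\setminus\bigcup_iW_i=B\text{ and the sets }W_i\text{ are pairwise disjoint}\Bigr\}$$ is $(\delta_5;\delta_6)$-computable. -/

import Mathlib

open Set Filter Topology TopologicalSpace

/-! ### Computability on Baire space -/

namespace DugundjiZD

/-- The finite prefix `p 0, …, p (n - 1)` of a point of Baire space. -/
def pre (p : ℕ → ℕ) (n : ℕ) : List ℕ := (List.range n).map p

/-- The word function `h` produces `q` from `p`: the words `h (p 0 … p (n - 1))` are prefixes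
of `q` of unbounded length. -/
def Produces (h : List ℕ → List ℕ) (p q : ℕ → ℕ) : Prop :=
  (∀ n, h (pre p n) = pre q (h (pre p n)).length) ∧ ∀ k, ∃ n, k ≤ (h (pre p n)).length

/-- The word functions that induce the computable partial functions `ℕ^ℕ → ℕ^ℕ` (those computed
by Type-2 machines): computable and monotone for the prefix order. The induced partial function
sends `p` to the `q` with `Produces h p q`, when there is one. -/
structure IsType2Program (h : List ℕ → List ℕ) : Prop where
  computable : Computable h
  monotone : ∀ u v : List ℕ, u <+: v → h u <+: h v

/-- `⟨p, q⟩` has even part `p` and odd part `q`. -/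
def evenPart (p : ℕ → ℕ) : ℕ → ℕ := fun i => p (2 * i)

/-- The second component of a pair in Baire space. -/
def oddPart (p : ℕ → ℕ) : ℕ → ℕ := fun i => p (2 * i + 1)

/-- The `j`-th component `p⁽ʲ⁾` of `p = ⟨p⁽⁰⁾, p⁽¹⁾, …⟩`, where `p ⟨j, k⟩ = p⁽ʲ⁾ k`. -/
def component (p : ℕ → ℕ) (j : ℕ) : ℕ → ℕ := fun k => p (Nat.pair j k)

/-! ### Representations -/

/-- A naming relation: `δ p x` says that `p` is a name of `x`. -/
abbrev Naming (S : Type*) := (ℕ → ℕ) → S → Prop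

/-- The naming relation is (the graph of) a partial surjection from Baire space onto `S`. -/
structure IsRepresentation {S : Type*} (δ : Naming S) : Prop where
  functional : ∀ p x y, δ p x → δ p y → x = y
  surjective : ∀ x, ∃ p, δ p x

/-- `[δ, δ']`. -/
def prodName {S T : Type*} (δ : Naming S) (δ' : Naming T) : Naming (S × T) :=
  fun p x => δ (evenPart p) x.1 ∧ δ' (oddPart p) x.2

/-- `δ ⊓ δ'`: a name consists of a `δ`-name and a `δ'`-name of the same object. -/
def infName {S : Type*} (δ δ' : Naming S) : Naming S :=
  fun p x => δ (evenPart p) x ∧ δ' (oddPart p) x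

/-- `δ^ω`, for sequences. -/
def seqName {S : Type*} (δ : Naming S) : Naming (ℕ → S) :=
  fun p x => ∀ j, δ (component p j) (x j)

/-- The restriction `δ|^T` to names of elements of `T`. -/
def restrictName {S : Type*} (δ : Naming S) (T : Set S) : Naming T :=
  fun p x => δ p x.1

/-- The multivalued operation `f` with domain `D` is `(δ, δ')`-computable: it has a computable
realizer. -/
def ComputableOperation {S T : Type*} (δ : Naming S) (δ' : Naming T) (D : Set S)
    (f : S → Set T) : Prop :=
  ∃ h : List ℕ → List ℕ, IsType2Program h ∧
    ∀ x ∈ D, ∀ p, δ p x → ∃ q, Produces h p q ∧ ∃ y ∈ f x, δ' q y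

/-- `δ ≤ δ'`: names can be computably translated. -/
def ReducibleTo {S : Type*} (δ δ' : Naming S) : Prop :=
  ∃ h : List ℕ → List ℕ, IsType2Program h ∧
    ∀ x p, δ p x → ∃ q, Produces h p q ∧ δ' q x

/-- `q ∈ dom η_p` and `η_p(q) = t`, for the representation `η` of the continuous partial functions
`ℕ^ℕ → ℕ^ℕ` with `G_δ` domain by Kleene associates (it has the utm and smn properties, which
determine `η` up to computable equivalence): the value `t n` is `p (code (n :: w)) - 1` for the
shortest prefix `w` of `q` with `p (code (n :: w)) ≠ 0`. -/
def EtaValue (p q t : ℕ → ℕ) : Prop :=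
  ∀ n, ∃ m, p (Encodable.encode (n :: pre q m)) = t n + 1 ∧
    ∀ m' < m, p (Encodable.encode (n :: pre q m')) = 0

/-! ### Rational and extended real numbers -/

/-- A standard total numbering of the positive rationals. -/
def nuQpos (r : ℕ) : ℚ := ((r.unpair.1 : ℚ) + 1) / ((r.unpair.2 : ℚ) + 1)

/-- A standard total numbering of the rationals. -/
def nuQ (n : ℕ) : ℚ :=
  ((n.unpair.1 : ℚ) - (n.unpair.2.unpair.1 : ℚ)) / ((n.unpair.2.unpair.2 : ℚ) + 1)

/-- The representation of `[-∞, ∞]` by enumerations of all smaller rationals. -/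
def lowerName : Naming EReal :=
  fun p t => {n : ℕ | (((nuQ n : ℚ) : ℝ) : EReal) < t} = {n : ℕ | ∃ i, p i = n + 1}

/-! ### Computable metric spaces and hyperspaces -/

section Metric

variable {X : Type*} [MetricSpace X]

/-- `(X, d, ν)` is a computable metric space. -/
structure IsComputableMetricSpace (ν : ℕ → X) : Prop where
  dense : DenseRange ν
  dist_computable : ∃ f : ℕ × ℕ × ℕ → ℕ, Computable f ∧
    ∀ i j k, |dist (ν i) (ν j) - ((nuQ (f (i, j, k)) : ℚ) : ℝ)| ≤ (2 : ℝ)⁻¹ ^ k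

/-- The Cauchy representation of `X`. -/
def pointName (ν : ℕ → X) : Naming X :=
  fun p x => (∀ i j, dist (ν (p i)) (ν (p j)) < (2 : ℝ)⁻¹ ^ min i j) ∧
    Tendsto (fun i => ν (p i)) atTop (𝓝 x)

/-- The standard ball numbering `α`. -/
def ballNum (ν : ℕ → X) (a : ℕ) : Set X :=
  Metric.ball (ν a.unpair.1) ((nuQpos a.unpair.2 : ℚ) : ℝ)

/-- The shift `α'` of `α`: `α' 0 = ∅` and `α' (n + 1) = α n`. -/
def ballNumShift (ν : ℕ → X) : ℕ → Set X
  | 0 => ∅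
  | n + 1 => ballNum ν n

/-- The representation `δ_{Σ⁰₁(X)}` of the open sets, by enumerations of ideal balls. -/
def openName (ν : ℕ → X) : Naming (Opens X) :=
  fun p U => (U : Set X) = ⋃ i, ballNumShift ν (p i)

/-- The representation `δ_{Π⁰₁(X)}` of the closed sets: a name of `A` is a name of `X \ A`. -/
def closedName (ν : ℕ → X) : Naming (Closeds X) :=
  fun p A => openName ν p A.compl

/-- The representation `δ_range` of the closed sets by dense sequences; a point is named by its
Cauchy name with all entries increased by one, and `∅` is named by the zero sequence. -/
def rangeName (ν : ℕ → X) : Naming (Closeds X) :=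
  fun p A => ((A : Set X) = ∅ ∧ ∀ i, component p i = fun _ => 0) ∨
    ((A : Set X).Nonempty ∧
      (∀ i, (∀ k, 1 ≤ component p i k) ∧
        ∃ x ∈ A, pointName ν (fun k => component p i k - 1) x) ∧
      ∀ x ∈ A, ∀ U : Set X, IsOpen U → x ∈ U →
        ∃ i, ∃ y ∈ U, pointName ν (fun k => component p i k - 1) y)

/-- The representation `δ_dist^>` of the closed sets: `η_p` computes, from names of `x`, the
rational lower bounds of `d_A(x)` (with `d_∅ = ∞`). -/
def distName (ν : ℕ → X) : Naming (Closeds X) :=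
  fun p A => ∀ q x, pointName ν q x →
    ∃ t, EtaValue p q t ∧ lowerName t ((Metric.infEDist x (A : Set X) : ENNReal) : EReal)

/-! ### Dugundji systems -/

/-- `(V i)` is locally finite in its union. -/
def LocallyFiniteInUnion (V : ℕ → Opens X) : Prop :=
  ∀ i, ∀ x ∈ V i, ∃ U : Set X, IsOpen U ∧ x ∈ U ∧ {j | ((V j : Set X) ∩ U).Nonempty}.Finite

/-- The distance `d(V, A)` of two sets, with value `∞` if one of them is empty. -/
noncomputable def setDist (V A : Set X) : ENNReal := ⨅ x ∈ V, Metric.infEDist x A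

/-- `((V i), (y i))` is a Dugundji system for the nonempty closed set `A`, with coefficient
`1 + ε`. -/
structure IsDugundjiSystemFor (ε : ℝ) (A : Closeds X) (V : ℕ → Opens X) (y : ℕ → X) : Prop where
  nonempty : (A : Set X).Nonempty
  locallyFinite : LocallyFiniteInUnion V
  iUnion_eq : ⋃ i, (V i : Set X) = (A : Set X)ᶜ
  mem : ∀ i, y i ∈ A
  dist_le : ∀ i, ∀ x ∈ V i, dist x (y i) ≤ (1 + ε) * Metric.infDist x (A : Set X)
  small : ∀ n : ℕ → ℕ, Tendsto (fun i => setDist (V (n i) : Set X) (A : Set X)) atTop (𝓝 0) →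
    Tendsto (fun i => Metric.ediam (V (n i) : Set X)) atTop (𝓝 0)

/-- The set `𝒟(X)` of the Dugundji systems in `X` with coefficient `2` (for the complement of
their union). -/
def DugundjiSystems (X : Type*) [MetricSpace X] : Set ((ℕ → Opens X) × (ℕ → X)) :=
  {D | IsDugundjiSystemFor 1 (⨆ i, D.1 i).compl D.1 D.2}

/-- The trace `V ∩ A` as an open set of the subspace `A`. -/
def traceOpen (A : Closeds X) (V : Opens X) : Opens (A : Set X) :=
  ⟨Subtype.val ⁻¹' (V : Set X), V.isOpen.preimage continuous_subtype_val⟩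

/-- The set `𝒟(X, A)` of Dugundji systems relative to `A`: `((V i ∩ A), (y i)) ∈ 𝒟(A)`. -/
def RelDugundjiSystems (A : Closeds X) : Set ((ℕ → Opens X) × (ℕ → X)) :=
  {D | ∃ hy : ∀ i, D.2 i ∈ (A : Set X),
    ((fun i => traceOpen A (D.1 i)), fun i => (⟨D.2 i, hy i⟩ : (A : Set X))) ∈
      DugundjiSystems (A : Set X)}

/-! ### Classes of closed sets and the representations of inputs and outputs -/

/-- The shifted basis numbering of the subspace `A`, `α'_A n = α' n ∩ A`. -/
def ballNumRel (ν : ℕ → X) (A : Closeds X) (n : ℕ) : Set (A : Set X) :=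
  Subtype.val ⁻¹' ballNumShift ν n

/-- The representation `δ_{Σ⁰₁(A)}` of the open sets of the subspace `A` induced by
the basis numbering `α_A`. -/
def openNameRel (ν : ℕ → X) (A : Closeds X) : Naming (Opens (A : Set X)) :=
  fun p U => (U : Set (A : Set X)) = ⋃ i, ballNumRel ν A (p i)

/-- The representation `δ_{Σ⁰₁(A), α'_A}` of the sequences of open sets of `A` which are locally
finite in their union: `⟨p, ⟨q, r⟩⟩` is a name of `(U j)` if `p` is a name of the sequence, the
sets `α'_A (q i)` have the same union as the `U j`, and `r i` is the code (by binary digits) of a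
finite set containing all `j` with `U j ∩ α'_A (q i) ≠ ∅`. -/
def lfNameRel (ν : ℕ → X) (A : Closeds X) : Naming (ℕ → Opens (A : Set X)) :=
  fun p U => seqName (openNameRel ν A) (evenPart p) U ∧
    (⋃ j, (U j : Set (A : Set X))) = ⋃ i, ballNumRel ν A (evenPart (oddPart p) i) ∧
    ∀ i j, ((U j : Set (A : Set X)) ∩ ballNumRel ν A (evenPart (oddPart p) i)).Nonempty →
      (oddPart (oddPart p) i).testBit j = true

/-- `E`: triples `(A; (V i), (y i))` with `A ∈ 𝒴` and `((V i), (y i)) ∈ 𝒟(X, A)`. -/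
def SystemsOver (𝒴 : Set (Closeds X)) : Set (𝒴 × (ℕ → Opens X) × (ℕ → X)) :=
  {e | e.2 ∈ RelDugundjiSystems e.1.1}

/-- `F`: pairs `(A, B)` with `A ∈ 𝒴`, `B` closed and `∅ ≠ B ⊆ A`. -/
def PairsOver (𝒴 : Set (Closeds X)) : Set (𝒴 × Closeds X) :=
  {P | (P.2 : Set X).Nonempty ∧ (P.2 : Set X) ⊆ (P.1.1 : Set X)}

/-- `π' (A; (V i), (y i)) = (A, A \ ⋃ i, V i)`. -/
def projPair {𝒴 : Set (Closeds X)} (e : SystemsOver 𝒴) : 𝒴 × Closeds X :=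
  (e.1.1, e.1.1.1 ⊓ (⨆ i, e.1.2.1 i).compl)

/-- `δ₅ = [δ_𝒴, δ_range ⊓ δ_dist^>]|^F`. -/
def inputName (ν : ℕ → X) (𝒴 : Set (Closeds X)) (δY : Naming 𝒴) : Naming (PairsOver 𝒴) :=
  restrictName (prodName δY (infName (rangeName ν) (distName ν))) (PairsOver 𝒴)

/-- `δ₆`: a name `⟨p, ⟨p', ⟨u, t⟩⟩⟩` of `(A; (V i), (y i))` consists of a name `p` of `A`, a name
`p'` of `(V i)`, a name `u` of `(V i ∩ A)` that witnesses local finiteness in `A`, and a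
name `t` of `(y i)`. -/
def outputName (ν : ℕ → X) (𝒴 : Set (Closeds X)) (δY : Naming 𝒴) : Naming (SystemsOver 𝒴) :=
  fun p e =>
    δY (evenPart p) e.1.1 ∧
    seqName (openName ν) (evenPart (oddPart p)) e.1.2.1 ∧
    lfNameRel ν e.1.1.1 (evenPart (oddPart (oddPart p))) (fun i => traceOpen e.1.1.1 (e.1.2.1 i)) ∧
    seqName (pointName ν) (oddPart (oddPart (oddPart p))) e.1.2.2

/-! ### The two operations -/

/-- The disjointification operation `S̃`. -/
def disjointify (𝒴 : Set (Closeds X)) (a : (ℕ → Opens X) × 𝒴) : Set (ℕ → Opens X) :=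
  {W | (∀ i, (W i : Set X) ⊆ (a.1 i : Set X)) ∧
    (⋃ i, (W i : Set X)) ∩ (a.2.1 : Set X) = (⋃ i, (a.1 i : Set X)) ∩ (a.2.1 : Set X) ∧
    ∀ i j, i ≠ j → (W i : Set X) ∩ (W j : Set X) = ∅}

/-- The operation `R'`: the Dugundji systems for `B` relative to `A` with pairwise disjoint
open sets. -/
def disjointSystems (𝒴 : Set (Closeds X)) (P : PairsOver 𝒴) : Set (SystemsOver 𝒴) :=
  {e | projPair e = P.1 ∧
    ∀ i j, i ≠ j → (e.1.2.1 i : Set X) ∩ (e.1.2.1 j : Set X) = ∅}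

end Metric

end DugundjiZD

/-!
The balls `B(ν a, ρ)` for which `8 ρ < d(ν a, B)` cover `X ∖ B` already when the radii are rational,
and each of them admits a point `b` of the dense sequence in `B` with `2 d(ν a, b) < 3 d(ν a, B)`.
Both inequalities are confirmed by some lower bound for `d(ν a, B)` and a sufficiently precise
approximation of `d(ν a, b)`, so such balls and points can be enumerated from a name of `B`. They
form a Whitney cover `V` of `X ∖ B`: every `x ∈ V i` satisfies `diam V i ≤ d(x, B)` and
`d(x, y i) ≤ 2 d(x, B)`. These bounds pass to smaller open sets, so a disjoint refinement `W` of `V`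
with the same trace on `A` is a Dugundji system for `B` relative to `A`: disjointness implies local
finiteness, and a ball contained in `W j` meets no other `W i`.
-/

namespace DugundjiZD

/-! ### Functionals computable with an oracle -/

section Words

theorem mem_getElem?_pre {p : ℕ → ℕ} {n i s : ℕ} : s ∈ (pre p n)[i]? ↔ i < n ∧ p i = s := by
  simp [pre, List.getElem?_eq_some_iff]

theorem pre_prefix_pre (p : ℕ → ℕ) {n m : ℕ} (h : n ≤ m) : pre p n <+: pre p m := by
  obtain ⟨k, rfl⟩ := Nat.exists_eq_add_of_le h
  simp only [pre, List.range_add, List.map_append, List.prefix_append]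

theorem prefix_iff_forall_mem_getElem? {β : Type*} {u v : List β} :
    u <+: v ↔ ∀ (i : ℕ) (s : β), s ∈ u[i]? → s ∈ v[i]? := by
  rw [List.prefix_iff_getElem?]
  refine ⟨fun h i s hs => ?_, fun h i hi => h i _ (List.getElem?_eq_getElem hi)⟩
  obtain ⟨hi, rfl⟩ := List.getElem?_eq_some_iff.1 hs
  exact h i hi

end Words

section Programs

variable {h : List ℕ → List ℕ} {p q q' : ℕ → ℕ}

theorem IsType2Program.produces_iff (hh : IsType2Program h) :
    Produces h p q ↔ ∀ i, ∀ᶠ n in atTop, q i ∈ (h (pre p n))[i]? := by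
  refine ⟨fun hpq i => ?_, fun hpq => ⟨fun n => List.ext_getElem? fun i => ?_, fun k => ?_⟩⟩
  · obtain ⟨n₀, hn₀⟩ := hpq.2 (i + 1)
    filter_upwards [eventually_ge_atTop n₀] with n hn
    have := (hh.monotone _ _ (pre_prefix_pre p hn)).length_le
    rw [hpq.1 n, mem_getElem?_pre]
    exact ⟨by omega, rfl⟩
  · refine Option.ext fun s => ?_
    obtain ⟨m, hm, hnm⟩ := ((hpq i).and (eventually_ge_atTop n)).exists
    have hprefix := hh.monotone _ _ (pre_prefix_pre p hnm)
    have key : ∀ s ∈ (h (pre p n))[i]?, q i = s := fun s hs =>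
      Option.mem_unique hm (prefix_iff_forall_mem_getElem?.1 hprefix i s hs)
    refine Iff.trans ⟨fun hs => ⟨(List.getElem?_eq_some_iff.1 hs).1, key s hs⟩, ?_⟩
      mem_getElem?_pre.symm
    rintro ⟨hi, rfl⟩
    rw [key _ (List.getElem?_eq_getElem hi)]
    exact List.getElem?_eq_getElem hi
  · obtain ⟨n, hn⟩ := (hpq k).exists
    exact ⟨n, (List.getElem?_eq_some_iff.1 hn).1.le⟩

theorem Produces.unique (hh : IsType2Program h) (hq : Produces h p q) (hq' : Produces h p q') :
    q = q' := by
  funext i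
  obtain ⟨n, hn, hn'⟩ := ((hh.produces_iff.1 hq i).and (hh.produces_iff.1 hq' i)).exists
  exact Option.mem_unique hn hn'

end Programs

variable {α β σ τ : Type*} [Primcodable α] [Primcodable β] [Primcodable σ] [Primcodable τ]
  {D E : Set (ℕ → ℕ)}

/-- For oracles `p ∈ D`, the value `F p a` is computable from `a` and `p`, uniformly in both: an
algorithm inspects longer and longer prefixes of `p` until it knows the value. That an inspection
is inconclusive is encoded by the value `none`. -/
def OracleComputableOn (D : Set (ℕ → ℕ)) (F : (ℕ → ℕ) → α → σ) : Prop :=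
  ∃ g : α × List ℕ → Option σ, Computable g ∧
    (∀ a u v, u <+: v → ∀ s ∈ g (a, u), s ∈ g (a, v)) ∧
    ∀ p ∈ D, ∀ a, ∀ᶠ n in atTop, F p a ∈ g (a, pre p n)

namespace OracleComputableOn

theorem of_computable {f : α → σ} (hf : Computable f) : OracleComputableOn D fun _ => f :=
  ⟨fun x => some (f x.1), Computable.option_some.comp (hf.comp Computable.fst),
    fun _ _ _ _ _ hs => hs, fun _ _ _ => Eventually.of_forall fun _ => rfl⟩

theorem oracle : OracleComputableOn D fun p => p := by
  refine ⟨fun x => x.2[x.1]?, Computable.list_getElem?.comp Computable.snd Computable.fst,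
    fun a u v huv => prefix_iff_forall_mem_getElem?.1 huv a, fun p _ a => ?_⟩
  filter_upwards [eventually_gt_atTop a] with n hn
  exact mem_getElem?_pre.2 ⟨hn, rfl⟩

theorem comp {G : (ℕ → ℕ) → β → σ} {F : (ℕ → ℕ) → α → β} (hG : OracleComputableOn D G)
    (hF : OracleComputableOn D F) : OracleComputableOn D fun p a => G p (F p a) := by
  obtain ⟨g, hg, hg_mono, hgG⟩ := hG
  obtain ⟨f, hf, hf_mono, hfF⟩ := hF
  refine ⟨fun x => (f x).bind fun b => g (b, x.2), ?_, fun a u v huv s hs => ?_, fun p hp a => ?_⟩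
  · exact Computable.option_bind hf
      (hg.comp (Computable.snd.pair (Computable.snd.comp Computable.fst))).to₂
  · obtain ⟨b, hb, hs⟩ := Option.mem_bind_iff.1 hs
    exact Option.mem_bind_iff.2 ⟨b, hf_mono a u v huv b hb, hg_mono b u v huv s hs⟩
  · filter_upwards [hfF p hp a, hgG p hp (F p a)] with n hb hs
    exact Option.mem_bind_iff.2 ⟨_, hb, hs⟩

theorem map {f : σ → τ} (hf : Computable f) {F : (ℕ → ℕ) → α → σ} (hF : OracleComputableOn D F) :
    OracleComputableOn D fun p a => f (F p a) :=
  (of_computable hf).comp hF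

theorem comp_computable {f : α → β} {F : (ℕ → ℕ) → β → σ} (hF : OracleComputableOn D F)
    (hf : Computable f) : OracleComputableOn D fun p a => F p (f a) :=
  hF.comp (of_computable hf)

theorem prodMk {F : (ℕ → ℕ) → α → σ} {G : (ℕ → ℕ) → α → τ} (hF : OracleComputableOn D F)
    (hG : OracleComputableOn D G) : OracleComputableOn D fun p a => (F p a, G p a) := by
  obtain ⟨f, hf, hf_mono, hfF⟩ := hF
  obtain ⟨g, hg, hg_mono, hgG⟩ := hG
  refine ⟨fun x => (f x).bind fun s => (g x).map fun t => (s, t), ?_, fun a u v huv x hx => ?_,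
    fun p hp a => ?_⟩
  · exact Computable.option_bind hf (Computable.option_map (hg.comp Computable.fst)
      ((Computable.snd.comp Computable.fst).pair Computable.snd).to₂).to₂
  · obtain ⟨s, hs, hst⟩ := Option.mem_bind_iff.1 hx
    obtain ⟨t, ht, rfl⟩ := Option.mem_map.1 hst
    exact Option.mem_bind_iff.2
      ⟨s, hf_mono a u v huv s hs, Option.mem_map.2 ⟨t, hg_mono a u v huv t ht, rfl⟩⟩
  · filter_upwards [hfF p hp a, hgG p hp a] with n hs ht
    exact Option.mem_bind_iff.2 ⟨_, hs, Option.mem_map.2 ⟨_, ht, rfl⟩⟩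

theorem nat_rec {F : (ℕ → ℕ) → α → σ} {G : (ℕ → ℕ) → α × ℕ × σ → σ}
    (hF : OracleComputableOn D F) (hG : OracleComputableOn D G) :
    OracleComputableOn D fun p (x : α × ℕ) =>
      Nat.rec (motive := fun _ => σ) (F p x.1) (fun n s => G p (x.1, n, s)) x.2 := by
  obtain ⟨f, hf, hf_mono, hfF⟩ := hF
  obtain ⟨g, hg, hg_mono, hgG⟩ := hG
  refine ⟨fun x => Nat.rec (motive := fun _ => Option σ) (f (x.1.1, x.2))
    (fun n o => o.bind fun s => g ((x.1.1, n, s), x.2)) x.1.2, ?_, ?_, ?_⟩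
  · have hbase : Computable fun x : (α × ℕ) × List ℕ => f (x.1.1, x.2) :=
      hf.comp ((Computable.fst.comp Computable.fst).pair Computable.snd)
    have hargs : Computable fun y : (((α × ℕ) × List ℕ) × ℕ × Option σ) × σ =>
        ((y.1.1.1.1, y.1.2.1, y.2), y.1.1.2) := by
      have hx : Computable fun y : (((α × ℕ) × List ℕ) × ℕ × Option σ) × σ => y.1.1 :=
        Computable.fst.comp Computable.fst
      have hn : Computable fun y : (((α × ℕ) × List ℕ) × ℕ × Option σ) × σ => y.1.2.1 :=
        Computable.fst.comp (Computable.snd.comp Computable.fst)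
      exact ((Computable.fst.comp (Computable.fst.comp hx)).pair (hn.pair Computable.snd)).pair
        (Computable.snd.comp hx)
    have hstep : Computable fun y : ((α × ℕ) × List ℕ) × ℕ × Option σ =>
        y.2.2.bind fun s => g ((y.1.1.1, y.2.1, s), y.1.2) :=
      Computable.option_bind (Computable.snd.comp Computable.snd) (hg.comp hargs).to₂
    have hrec := Computable.nat_rec (Computable.snd.comp Computable.fst) hbase hstep.to₂
    exact hrec
  · rintro ⟨a, n⟩ u v huv
    induction n with
    | zero => exact hf_mono a u v huv
    | succ n ih =>
      intro s hs
      obtain ⟨b, hb, hs⟩ := Option.mem_bind_iff.1 hs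
      exact Option.mem_bind_iff.2 ⟨b, ih b hb, hg_mono _ u v huv s hs⟩
  · rintro p hp ⟨a, n⟩
    induction n with
    | zero => exact hfF p hp a
    | succ n ih =>
      filter_upwards [ih, hgG p hp (a, n, _)] with m hb hs
      exact Option.mem_bind_iff.2 ⟨_, hb, hs⟩

end OracleComputableOn

theorem computable_map_range {f : α → ℕ} {g : α → ℕ → σ} (hf : Computable f)
    (hg : Computable₂ g) : Computable fun a => (List.range (f a)).map (g a) := by
  have hrec : Computable fun a => Nat.rec (motive := fun _ => List σ) []
      (fun n l => l ++ [g a n]) (f a) :=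
    Computable.nat_rec hf (Computable.const []) <|
      (Computable.list_concat.comp (Computable.snd.comp Computable.snd)
        (hg.comp Computable.fst (Computable.fst.comp Computable.snd))).to₂
  refine hrec.of_eq fun a => ?_
  induction f a with
  | zero => rfl
  | succ n ih => simp only [List.range_succ, List.map_append, List.map_singleton, ih]

/-- The word function that, from an input word `u` of length `l`, outputs the values
`g (0, u), g (1, u), …, g (l - 1, u)` up to the first undefined one. -/
def outputWord (g : ℕ × List ℕ → Option ℕ) (u : List ℕ) : List ℕ :=
  let outputs := (List.range u.length).map fun n => g (n, u)
  (outputs.take (outputs.findIdx Option.isNone)).map fun o => o.getD 0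

theorem mem_getElem?_outputWord {g : ℕ × List ℕ → Option ℕ} {u : List ℕ} {i s : ℕ} :
    s ∈ (outputWord g u)[i]? ↔
      i < u.length ∧ (∀ j < i, (g (j, u)).isSome) ∧ s ∈ g (i, u) := by
  have hcut : i < ((List.range u.length).map fun n => g (n, u)).findIdx Option.isNone ↔
      i < u.length ∧ (∀ j < i, (g (j, u)).isSome) ∧ (g (i, u)).isSome := by
    simp only [List.lt_findIdx_iff, List.length_map, List.length_range, List.getElem_map,
      List.getElem_range, Option.isNone_eq_false_iff, exists_prop, Nat.le_iff_lt_or_eq, or_imp,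
      forall_and, forall_eq]
  by_cases hi : i < u.length ∧ (∀ j < i, (g (j, u)).isSome) ∧ (g (i, u)).isSome
  · obtain ⟨t, ht⟩ := Option.isSome_iff_exists.1 hi.2.2
    simp only [outputWord, List.getElem?_map, List.getElem?_take, if_pos (hcut.2 hi),
      List.getElem?_range hi.1, Option.map_some, ht, Option.getD_some]
    exact ⟨fun hs => ⟨hi.1, hi.2.1, hs⟩, fun hs => hs.2.2⟩
  · have hnone : (outputWord g u)[i]? = none := by
      simp only [outputWord, List.getElem?_map, List.getElem?_take, if_neg (mt hcut.1 hi),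
        Option.map_none]
    rw [hnone]
    refine ⟨fun hs => absurd hs (Option.not_mem_none s), fun ⟨hlt, hsome, hs⟩ => ?_⟩
    exact absurd ⟨hlt, hsome, Option.isSome_iff_exists.2 ⟨s, hs⟩⟩ hi

theorem computable_outputWord {g : ℕ × List ℕ → Option ℕ} (hg : Computable g) :
    Computable (outputWord g) := by
  have hcut : Primrec fun l : List (Option ℕ) =>
      (l.take (l.findIdx Option.isNone)).map fun o => o.getD 0 := by
    have hnone : Primrec fun o : Option ℕ => o.isNone :=
      (Primrec.not.comp Primrec.option_isSome).of_eq fun o => by cases o <;> rfl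
    have hgetD : Primrec fun o : Option ℕ => o.getD 0 :=
      Primrec.option_getD.comp Primrec.id (Primrec.const 0)
    exact Primrec.list_map (Primrec.list_take.comp
      (Primrec.list_findIdx Primrec.id (hnone.comp Primrec.snd).to₂) Primrec.id)
      (hgetD.comp Primrec.snd).to₂
  exact hcut.to_comp.comp (computable_map_range Computable.list_length
    (hg.comp (Computable.snd.pair Computable.fst)).to₂)

theorem oracleComputableOn_iff_exists_program {G : (ℕ → ℕ) → ℕ → ℕ} :
    OracleComputableOn D G ↔ ∃ h, IsType2Program h ∧ ∀ p ∈ D, Produces h p (G p) := by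
  constructor
  · rintro ⟨g, hg, hg_mono, hgG⟩
    have hprogram : IsType2Program (outputWord g) := by
      refine ⟨computable_outputWord hg, fun u v huv =>
        prefix_iff_forall_mem_getElem?.2 fun i s hs => ?_⟩
      obtain ⟨hi, hsome, hs⟩ := mem_getElem?_outputWord.1 hs
      refine mem_getElem?_outputWord.2 ⟨hi.trans_le huv.length_le, fun j hj => ?_,
        hg_mono i u v huv s hs⟩
      obtain ⟨t, ht⟩ := Option.isSome_iff_exists.1 (hsome j hj)
      exact Option.isSome_iff_exists.2 ⟨t, hg_mono j u v huv t ht⟩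
    refine ⟨_, hprogram, fun p hp => hprogram.produces_iff.2 fun i => ?_⟩
    have hbelow : ∀ᶠ n in atTop, ∀ j ∈ Set.Iio i, G p j ∈ g (j, pre p n) :=
      (eventually_all_finite (finite_Iio i)).2 fun j _ => hgG p hp j
    filter_upwards [hbelow, hgG p hp i, eventually_gt_atTop i] with n hj hi hin
    refine mem_getElem?_outputWord.2 ⟨by simpa [pre] using hin, fun j hji => ?_, hi⟩
    exact Option.isSome_iff_exists.2 ⟨_, hj j hji⟩
  · rintro ⟨h, hh, hG⟩
    exact ⟨fun x => (h x.2)[x.1]?,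
      Computable.list_getElem?.comp (hh.computable.comp Computable.snd) Computable.fst,
      fun a u v huv => prefix_iff_forall_mem_getElem?.1 (hh.monotone u v huv) a,
      fun p hp => hh.produces_iff.1 (hG p hp)⟩

theorem OracleComputableOn.subst {F : (ℕ → ℕ) → α → σ} {G : (ℕ → ℕ) → ℕ → ℕ}
    (hF : OracleComputableOn E F) (hG : OracleComputableOn D G) (hDE : MapsTo G D E) :
    OracleComputableOn D fun p => F (G p) := by
  obtain ⟨f, hf, hf_mono, hfF⟩ := hF
  obtain ⟨h, hh, hhG⟩ := oracleComputableOn_iff_exists_program.1 hG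
  refine ⟨fun x => f (x.1, h x.2),
    hf.comp (Computable.fst.pair (hh.computable.comp Computable.snd)),
    fun a u v huv => hf_mono a _ _ (hh.monotone u v huv), fun p hp a => ?_⟩
  obtain ⟨m, hm⟩ := (hfF (G p) (hDE hp) a).exists
  obtain ⟨n₀, hn₀⟩ := (hhG p hp).2 m
  filter_upwards [eventually_ge_atTop n₀] with n hn
  refine hf_mono a _ _ ?_ _ hm
  rw [(hhG p hp).1 n]
  exact pre_prefix_pre _ (hn₀.trans (hh.monotone _ _ (pre_prefix_pre p hn)).length_le)

section Realizers

variable {S T : Type*} {δ : Naming S} {δ' : Naming T} {C C' : Set S} {f : S → Set T}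

theorem computableOperation_iff_exists_realizer :
    ComputableOperation δ δ' C f ↔ ∃ G : (ℕ → ℕ) → ℕ → ℕ,
      OracleComputableOn {p | ∃ x ∈ C, δ p x} G ∧
        ∀ x ∈ C, ∀ p, δ p x → ∃ y ∈ f x, δ' (G p) y := by
  constructor
  · rintro ⟨h, hh, hf⟩
    have houtput : ∀ p, ∃ q, (∃ x ∈ C, δ p x) → Produces h p q := by
      intro p
      by_cases hp : ∃ x ∈ C, δ p x
      · obtain ⟨x, hx, hpx⟩ := hp
        obtain ⟨q, hq, -⟩ := hf x hx p hpx
        exact ⟨q, fun _ => hq⟩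
      · exact ⟨p, fun h => absurd h hp⟩
    choose G hG using houtput
    refine ⟨G, oracleComputableOn_iff_exists_program.2 ⟨h, hh, hG⟩, fun x hx p hpx => ?_⟩
    obtain ⟨q, hq, hy⟩ := hf x hx p hpx
    rwa [(hG p ⟨x, hx, hpx⟩).unique hh hq]
  · rintro ⟨G, hG, hf⟩
    obtain ⟨h, hh, hhG⟩ := oracleComputableOn_iff_exists_program.1 hG
    exact ⟨h, hh, fun x hx p hpx => ⟨G p, hhG p ⟨x, hx, hpx⟩, hf x hx p hpx⟩⟩

theorem ComputableOperation.mono (h : ComputableOperation δ δ' C f) (hC : C' ⊆ C) :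
    ComputableOperation δ δ' C' f :=
  let ⟨g, hg, hf⟩ := h
  ⟨g, hg, fun x hx => hf x (hC hx)⟩

end Realizers

/-! ### Pairs and sequences in Baire space -/

/-- The pair `⟨p, q⟩`. -/
def interleave (p q : ℕ → ℕ) (i : ℕ) : ℕ := if i % 2 = 0 then p (i / 2) else q (i / 2)

/-- The tuple `⟨x 0, x 1, …⟩` of a sequence of points of Baire space. -/
def tuple (x : ℕ → ℕ → ℕ) (i : ℕ) : ℕ := x i.unpair.1 i.unpair.2

theorem evenPart_interleave (p q : ℕ → ℕ) : evenPart (interleave p q) = p := by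
  funext i
  simp only [evenPart, interleave, Nat.mul_mod_right, if_true, Nat.mul_div_cancel_left _ two_pos]

theorem oddPart_interleave (p q : ℕ → ℕ) : oddPart (interleave p q) = q := by
  funext i
  simp only [oddPart, interleave, show (2 * i + 1) % 2 ≠ 0 by lia, if_false,
    show (2 * i + 1) / 2 = i by lia]

theorem component_tuple (x : ℕ → ℕ → ℕ) (j : ℕ) : component (tuple x) j = x j := by
  funext k
  simp only [component, tuple, Nat.unpair_pair]

namespace OracleComputableOn

variable {P Q : (ℕ → ℕ) → ℕ → ℕ}

theorem evenPart (hP : OracleComputableOn D P) :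
    OracleComputableOn D fun p => evenPart (P p) :=
  hP.comp_computable (Primrec.nat_mul.comp (Primrec.const 2) Primrec.id).to_comp

theorem oddPart (hP : OracleComputableOn D P) : OracleComputableOn D fun p => oddPart (P p) :=
  hP.comp_computable
    (Primrec.succ.comp (Primrec.nat_mul.comp (Primrec.const 2) Primrec.id)).to_comp

theorem component (hP : OracleComputableOn D P) :
    OracleComputableOn D fun p (x : ℕ × ℕ) => component (P p) x.1 x.2 :=
  hP.comp_computable Primrec₂.natPair.to_comp

theorem interleave (hP : OracleComputableOn D P) (hQ : OracleComputableOn D Q) :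
    OracleComputableOn D fun p => interleave (P p) (Q p) := by
  have hhalf : Computable fun i : ℕ => i / 2 :=
    (Primrec.nat_div.comp Primrec.id (Primrec.const 2)).to_comp
  have hchoose : Primrec fun x : ℕ × ℕ × ℕ => if x.1 % 2 = 0 then x.2.1 else x.2.2 :=
    Primrec.ite (Primrec.eq.comp (Primrec.nat_mod.comp Primrec.fst (Primrec.const 2))
      (Primrec.const 0)) (Primrec.fst.comp Primrec.snd) (Primrec.snd.comp Primrec.snd)
  exact ((of_computable Computable.id).prodMk
    ((hP.comp_computable hhalf).prodMk (hQ.comp_computable hhalf))).map hchoose.to_comp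

theorem tuple {R : (ℕ → ℕ) → ℕ × ℕ → ℕ} (hR : OracleComputableOn D R) :
    OracleComputableOn D fun p => tuple fun j k => R p (j, k) :=
  hR.comp_computable Primrec.unpair.to_comp

end OracleComputableOn

/-! ### Rational numbers -/

theorem nuQ_surjective : Function.Surjective nuQ := by
  intro q
  have hnum : (q.num.toNat : ℚ) - ((-q.num).toNat : ℚ) = q.num := by
    have : (q.num.toNat : ℤ) - ((-q.num).toNat : ℤ) = q.num := by lia
    exact_mod_cast this
  have hden : ((q.den - 1 : ℕ) : ℚ) + 1 = q.den := by
    exact_mod_cast Nat.sub_add_cancel q.den_pos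
  refine ⟨Nat.pair q.num.toNat (Nat.pair (-q.num).toNat (q.den - 1)), ?_⟩
  simp only [nuQ, Nat.unpair_pair, hnum, hden, Rat.num_div_den]

theorem exists_nuQpos_eq {q : ℚ} (hq : 0 < q) : ∃ r, nuQpos r = q := by
  have hnum : ((q.num.toNat - 1 : ℕ) : ℚ) + 1 = q.num := by
    have : ((q.num.toNat - 1 : ℕ) : ℤ) + 1 = q.num := by
      have := Rat.num_pos.2 hq
      lia
    exact_mod_cast this
  have hden : ((q.den - 1 : ℕ) : ℚ) + 1 = q.den := by
    exact_mod_cast Nat.sub_add_cancel q.den_pos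
  refine ⟨Nat.pair (q.num.toNat - 1) (q.den - 1), ?_⟩
  simp only [nuQpos, Nat.unpair_pair, hnum, hden, Rat.num_div_den]

theorem primrec_two_pow : Primrec fun n : ℕ => 2 ^ n :=
  (Primrec₂.unpaired'.1 Nat.Primrec.pow).comp (Primrec.const 2) Primrec.id

/-- The rational-valued function `F` is primitive recursive, in the sense that `F x` is a fraction
`(a x - b x) / (d x + 1)` with `a`, `b`, `d` primitive recursive. -/
def PrimrecRat (F : α → ℚ) : Prop :=
  ∃ a b d : α → ℕ, Primrec a ∧ Primrec b ∧ Primrec d ∧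
    ∀ x, F x = ((a x : ℚ) - (b x : ℚ)) / ((d x : ℚ) + 1)

namespace PrimrecRat

variable {F G : α → ℚ} {f : α → ℕ}

theorem natCast (n : ℕ) : PrimrecRat fun _ : α => (n : ℚ) :=
  ⟨fun _ => n, fun _ => 0, fun _ => 0, Primrec.const _, Primrec.const _, Primrec.const _,
    fun _ => by simp only [Nat.cast_zero, sub_zero, zero_add, div_one]⟩

theorem nuQ (hf : Primrec f) : PrimrecRat fun x => nuQ (f x) := by
  have hdecode := Primrec.unpair.comp hf
  have hdecode₂ := Primrec.unpair.comp (Primrec.snd.comp hdecode)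
  exact ⟨_, _, _, Primrec.fst.comp hdecode, Primrec.fst.comp hdecode₂,
    Primrec.snd.comp hdecode₂, fun _ => rfl⟩

theorem nuQpos (hf : Primrec f) : PrimrecRat fun x => nuQpos (f x) := by
  have hdecode := Primrec.unpair.comp hf
  refine ⟨_, _, _, Primrec.succ.comp (Primrec.fst.comp hdecode), Primrec.const 0,
    Primrec.snd.comp hdecode, fun _ => ?_⟩
  simp only [DugundjiZD.nuQpos, Nat.cast_succ, Nat.cast_zero, sub_zero]

theorem inv_two_pow (hf : Primrec f) : PrimrecRat fun x => 2⁻¹ ^ f x := by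
  refine ⟨_, _, _, Primrec.const 1, Primrec.const 0,
    Primrec.pred.comp (primrec_two_pow.comp hf), fun x => ?_⟩
  have hpred : ((Nat.pred (2 ^ f x) : ℕ) : ℚ) + 1 = 2 ^ f x := by
    exact_mod_cast Nat.succ_pred (pow_ne_zero _ two_ne_zero)
  simp only [hpred, Nat.cast_one, Nat.cast_zero, sub_zero, inv_pow, one_div]

theorem add (hF : PrimrecRat F) (hG : PrimrecRat G) : PrimrecRat fun x => F x + G x := by
  obtain ⟨a, b, d, ha, hb, hd, hF⟩ := hF
  obtain ⟨a', b', d', ha', hb', hd', hG⟩ := hG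
  refine ⟨fun x => a x * (d' x + 1) + a' x * (d x + 1),
    fun x => b x * (d' x + 1) + b' x * (d x + 1), fun x => d x * d' x + d x + d' x,
    Primrec.nat_add.comp (Primrec.nat_mul.comp ha (Primrec.succ.comp hd'))
      (Primrec.nat_mul.comp ha' (Primrec.succ.comp hd)),
    Primrec.nat_add.comp (Primrec.nat_mul.comp hb (Primrec.succ.comp hd'))
      (Primrec.nat_mul.comp hb' (Primrec.succ.comp hd)),
    Primrec.nat_add.comp (Primrec.nat_add.comp (Primrec.nat_mul.comp hd hd') hd) hd', fun x => ?_⟩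
  have hden : (d x * d' x + d x + d' x + 1 : ℚ) = (d x + 1) * (d' x + 1) := by ring
  simp only [hF, hG, Nat.cast_add, Nat.cast_mul, Nat.cast_one, hden]
  field_simp
  ring

theorem mul (hF : PrimrecRat F) (hG : PrimrecRat G) : PrimrecRat fun x => F x * G x := by
  obtain ⟨a, b, d, ha, hb, hd, hF⟩ := hF
  obtain ⟨a', b', d', ha', hb', hd', hG⟩ := hG
  refine ⟨fun x => a x * a' x + b x * b' x, fun x => a x * b' x + b x * a' x,
    fun x => d x * d' x + d x + d' x,
    Primrec.nat_add.comp (Primrec.nat_mul.comp ha ha') (Primrec.nat_mul.comp hb hb'),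
    Primrec.nat_add.comp (Primrec.nat_mul.comp ha hb') (Primrec.nat_mul.comp hb ha'),
    Primrec.nat_add.comp (Primrec.nat_add.comp (Primrec.nat_mul.comp hd hd') hd) hd', fun x => ?_⟩
  have hden : (d x * d' x + d x + d' x + 1 : ℚ) = (d x + 1) * (d' x + 1) := by ring
  simp only [hF, hG, Nat.cast_add, Nat.cast_mul, hden]
  field_simp
  ring

theorem lt (hF : PrimrecRat F) (hG : PrimrecRat G) : PrimrecPred fun x => F x < G x := by
  obtain ⟨a, b, d, ha, hb, hd, hF⟩ := hF
  obtain ⟨a', b', d', ha', hb', hd', hG⟩ := hG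
  have hleft := Primrec.nat_add.comp (Primrec.nat_mul.comp ha (Primrec.succ.comp hd'))
    (Primrec.nat_mul.comp hb' (Primrec.succ.comp hd))
  have hright := Primrec.nat_add.comp (Primrec.nat_mul.comp ha' (Primrec.succ.comp hd))
    (Primrec.nat_mul.comp hb (Primrec.succ.comp hd'))
  refine (Primrec.nat_lt.comp hleft hright).of_eq fun x => ?_
  rw [hF, hG, div_lt_div_iff₀ (by positivity) (by positivity), ← Nat.cast_lt (α := ℚ)]
  push_cast
  constructor <;> intro h <;> linarith

end PrimrecRat

/-! ### Reading off lower bounds and approximations of distances -/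

/-- The result, increased by one, of searching the first `m` prefixes of `q` for one on which the
associate `p` decides the value at `n`; it is `0` if there is none. -/
def etaApprox (p q : ℕ → ℕ) (n : ℕ) : ℕ → ℕ
  | 0 => 0
  | m + 1 =>
    if etaApprox p q n m = 0 then p (Encodable.encode (n :: pre q m)) else etaApprox p q n m

theorem EtaValue.exists_etaApprox_eq {p q t : ℕ → ℕ} (h : EtaValue p q t) (n : ℕ) :
    ∃ m₀, ∀ m, etaApprox p q n m = if m ≤ m₀ then 0 else t n + 1 := by
  obtain ⟨m₀, hm₀, hlt⟩ := h n
  refine ⟨m₀, fun m => ?_⟩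
  induction m with
  | zero => rfl
  | succ m ih =>
    rw [etaApprox, ih]
    obtain hm | rfl | hm := lt_trichotomy m m₀
    · simp only [hm.le, Nat.succ_le_iff.2 hm, if_true, hlt m hm]
    · simp only [le_refl, if_true, hm₀, Nat.not_succ_le_self, if_false]
    · simp only [hm.not_ge, (hm.trans (Nat.lt_succ_self m)).not_ge, if_false, Nat.succ_ne_zero]

theorem OracleComputableOn.etaApprox {P : (ℕ → ℕ) → ℕ → ℕ} (hP : OracleComputableOn D P)
    {q : β → ℕ → ℕ} (hq : Computable₂ q) :
    OracleComputableOn D fun p (x : (β × ℕ) × ℕ) => etaApprox (P p) (q x.1.1) x.1.2 x.2 := by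
  have hquery : Computable fun x : (β × ℕ) × ℕ × ℕ =>
      Encodable.encode (x.1.2 :: pre (q x.1.1) x.2.1) :=
    Computable.encode.comp <| Computable.list_cons.comp (Computable.snd.comp Computable.fst) <|
      computable_map_range (Computable.fst.comp Computable.snd) <|
        (hq.comp ((Computable.fst.comp Computable.fst).comp Computable.fst) Computable.snd).to₂
  have hselect : Computable fun x : ℕ × ℕ => if x.1 = 0 then x.2 else x.1 :=
    (Primrec.ite (Primrec.eq.comp Primrec.fst (Primrec.const 0)) Primrec.snd Primrec.fst).to_comp
  have hstep : OracleComputableOn D fun p (x : (β × ℕ) × ℕ × ℕ) =>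
      if x.2.2 = 0 then P p (Encodable.encode (x.1.2 :: pre (q x.1.1) x.2.1)) else x.2.2 :=
    ((of_computable (Computable.snd.comp Computable.snd)).prodMk
      (hP.comp_computable hquery)).map hselect
  have hrec := nat_rec (of_computable (f := fun _ : β × ℕ => 0) (Computable.const 0)) hstep
  convert hrec using 3 with p x
  induction x.2 with
  | zero => rfl
  | succ m ih => simp only [DugundjiZD.etaApprox, ih]

section Metric

variable {X : Type*} [MetricSpace X] {ν : ℕ → X} {B : Closeds X} {x : X} {p : ℕ → ℕ}

/-- The function `f` computes the metric on the dense sequence `ν`, up to any given precision. -/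
def ApproximatesDist (ν : ℕ → X) (f : ℕ × ℕ × ℕ → ℕ) : Prop :=
  ∀ i j k, |dist (ν i) (ν j) - (nuQ (f (i, j, k)) : ℝ)| ≤ 2⁻¹ ^ k

theorem pointName_const (ν : ℕ → X) (a : ℕ) : pointName ν (fun _ => a) (ν a) :=
  ⟨fun i j => by rw [dist_self]; positivity, tendsto_const_nhds⟩

theorem pointName.dist_le (h : pointName ν p x) (m : ℕ) : dist (ν (p m)) x ≤ (2 : ℝ)⁻¹ ^ m := by
  refine le_of_tendsto (tendsto_const_nhds.dist h.2) ?_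
  filter_upwards [eventually_ge_atTop m] with i hi
  exact (min_eq_left hi ▸ h.1 m i).le

theorem pointName.abs_dist_sub_nuQ_le {f : ℕ × ℕ × ℕ → ℕ}
    (hf : ApproximatesDist ν f)
    (h : pointName ν p x) (a m : ℕ) :
    |dist (ν a) x - (nuQ (f (a, p m, m)) : ℝ)| ≤ 2 * 2⁻¹ ^ m :=
  calc |dist (ν a) x - (nuQ (f (a, p m, m)) : ℝ)|
      ≤ |dist (ν a) x - dist (ν a) (ν (p m))|
        + |dist (ν a) (ν (p m)) - (nuQ (f (a, p m, m)) : ℝ)| := abs_sub_le _ _ _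
    _ ≤ 2⁻¹ ^ m + 2⁻¹ ^ m := by
      refine add_le_add ?_ (hf _ _ _)
      rw [dist_comm (ν a), dist_comm (ν a)]
      exact (abs_dist_sub_le x (ν (p m)) (ν a)).trans (dist_comm x _ ▸ h.dist_le m)
    _ = 2 * 2⁻¹ ^ m := (two_mul _).symm

theorem distName.exists_etaValue (h : distName ν p B) (hB : (B : Set X).Nonempty) (a : ℕ) :
    ∃ t, EtaValue p (fun _ => a) t ∧
      ∀ c, (nuQ c : ℝ) < Metric.infDist (ν a) (B : Set X) ↔ ∃ n, t n = c + 1 := by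
  obtain ⟨t, ht, hlower⟩ := h _ _ (pointName_const ν a)
  refine ⟨t, ht, fun c => ?_⟩
  rw [Metric.infDist, ← EReal.coe_lt_coe_iff, EReal.coe_ennreal_toReal (Metric.infEDist_ne_top hB)]
  exact Set.ext_iff.1 hlower c

theorem rangeName.exists_dense_points (h : rangeName ν p B) (hB : (B : Set X).Nonempty) :
    ∃ b : ℕ → X, (∀ k, b k ∈ B) ∧ (B : Set X) ⊆ closure (range b) ∧
      ∀ k, pointName ν (fun m => component p k m - 1) (b k) := by
  obtain ⟨hempty, -⟩ | ⟨-, hpoints, hdense⟩ := h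
  · exact absurd hempty hB.ne_empty
  choose b hbB hb using fun k => (hpoints k).2
  refine ⟨b, hbB, fun x hx => mem_closure_iff.2 fun U hU hxU => ?_, hb⟩
  obtain ⟨k, y, hyU, hy⟩ := hdense x hx U hU hxU
  exact ⟨b k, tendsto_nhds_unique hy.2 (hb k).2 ▸ hyU, mem_range_self k⟩

end Metric

/-! ### Whitney covers -/

section Geometry

variable {X : Type*} [PseudoMetricSpace X] {B : Set X} {x z b : X} {ρ : ℝ}

/-- The ball `B(x, ρ)` is so small compared to its distance from `B`, and `b` is so close to it,
that the pair qualifies for a Dugundji system. Both inequalities are strict conditions on `x` and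
`b`, hence semidecidable. -/
structure IsAdmissibleBall (B : Set X) (x : X) (ρ : ℝ) (b : X) : Prop where
  radius_lt : 8 * ρ < Metric.infDist x B
  dist_lt : 2 * dist x b < 3 * Metric.infDist x B

namespace IsAdmissibleBall

theorem radius_lt_infDist (h : IsAdmissibleBall B x ρ b) (hz : z ∈ Metric.ball x ρ) :
    7 * ρ < Metric.infDist z B := by
  have hxz : Metric.infDist x B ≤ Metric.infDist z B + dist x z :=
    Metric.infDist_le_infDist_add_dist
  linarith [Metric.mem_ball'.1 hz, h.radius_lt]

theorem notMem (h : IsAdmissibleBall B x ρ b) (hz : z ∈ Metric.ball x ρ) : z ∉ B := fun hzB => by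
  have hzero := Metric.infDist_zero_of_mem hzB
  linarith [h.radius_lt_infDist hz, Metric.pos_of_mem_ball hz]

theorem dist_le (h : IsAdmissibleBall B x ρ b) (hz : z ∈ Metric.ball x ρ) :
    dist z b ≤ 2 * Metric.infDist z B := by
  have hxz : Metric.infDist x B ≤ Metric.infDist z B + dist x z :=
    Metric.infDist_le_infDist_add_dist
  linarith [dist_triangle_left z b x, Metric.mem_ball'.1 hz, Metric.pos_of_mem_ball hz,
    h.radius_lt_infDist hz, h.dist_lt]

theorem ediam_ball_le (h : IsAdmissibleBall B x ρ b) (hz : z ∈ Metric.ball x ρ) :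
    Metric.ediam (Metric.ball x ρ) ≤ Metric.infEDist z B := by
  have hρ := Metric.pos_of_mem_ball hz
  have hzB := h.radius_lt_infDist hz
  calc Metric.ediam (Metric.ball x ρ) ≤ ENNReal.ofReal (2 * ρ) := by
        rw [← Metric.eball_ofReal, ENNReal.ofReal_mul zero_le_two, ENNReal.ofReal_ofNat]
        exact Metric.ediam_eball_le
    _ ≤ ENNReal.ofReal (Metric.infDist z B) := ENNReal.ofReal_le_ofReal (by linarith)
    _ ≤ Metric.infEDist z B := ENNReal.ofReal_toReal_le

end IsAdmissibleBall

theorem exists_isAdmissibleBall {ν b : ℕ → X} (hν : DenseRange ν) (hbB : ∀ k, b k ∈ B)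
    (hb : B ⊆ closure (range b)) (hx : x ∉ closure B) :
    ∃ a r k, IsAdmissibleBall B (ν a) (nuQpos r) (b k) ∧ x ∈ Metric.ball (ν a) (nuQpos r) := by
  have hpos : 0 < Metric.infDist x B :=
    (Metric.infDist_pos_iff_notMem_closure ⟨b 0, hbB 0⟩).1 hx
  have hrange : Metric.infDist x (range b) = Metric.infDist x B := by
    refine le_antisymm ?_ (Metric.infDist_le_infDist_of_subset (range_subset_iff.2 hbB)
      (range_nonempty b))
    rw [← Metric.infDist_closure (s := range b)]
    exact Metric.infDist_le_infDist_of_subset hb ⟨_, hbB 0⟩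
  obtain ⟨-, ⟨k, rfl⟩, hk⟩ :=
    (Metric.infDist_lt_iff (x := x) (r := 6 / 5 * Metric.infDist x B) (range_nonempty b)).1
      (by linarith)
  obtain ⟨a, ha⟩ := hν.exists_dist_lt x (show 0 < Metric.infDist x B / 20 by positivity)
  obtain ⟨ρ, hρ, hρ'⟩ := exists_rat_btwn (show Metric.infDist x B / 20 < Metric.infDist x B / 10
    by linarith)
  obtain ⟨r, rfl⟩ := exists_nuQpos_eq (q := ρ) (by exact_mod_cast (by linarith : (0 : ℝ) < ρ))
  have hxa : Metric.infDist x B ≤ Metric.infDist (ν a) B + dist x (ν a) :=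
    Metric.infDist_le_infDist_add_dist
  refine ⟨a, r, k, ⟨by linarith, ?_⟩, Metric.mem_ball.2 (by linarith)⟩
  linarith [dist_triangle_left (ν a) (b k) x]

end Geometry

section Metric

variable {X : Type*} [MetricSpace X] {A B : Closeds X} {V W : ℕ → Opens X} {y : ℕ → X}

/-- A cover of the complement of `B` by open sets whose diameters and distances from the points
`y i` of `B` are controlled by the distance from `B`. These are the properties of a Dugundji
system that pass to smaller open sets with the same union. -/
structure IsWhitneyCover (B : Closeds X) (V : ℕ → Opens X) (y : ℕ → X) : Prop where
  iUnion_eq : ⋃ i, (V i : Set X) = (B : Set X)ᶜ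
  mem : ∀ i, y i ∈ B
  dist_le : ∀ i, ∀ x ∈ V i, dist x (y i) ≤ 2 * Metric.infDist x (B : Set X)
  ediam_le : ∀ i, ∀ x ∈ V i, Metric.ediam (V i : Set X) ≤ Metric.infEDist x (B : Set X)

theorem LocallyFiniteInUnion.of_pairwiseDisjoint
    (hV : ∀ i j, i ≠ j → (V i : Set X) ∩ (V j : Set X) = ∅) : LocallyFiniteInUnion V := by
  refine fun i x hx => ⟨V i, (V i).isOpen, hx, (finite_singleton i).subset fun j hj => ?_⟩
  by_contra hji
  exact hj.ne_empty (hV j i hji)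

namespace IsWhitneyCover

theorem compl_iSup_eq (h : IsWhitneyCover B V y) : (⨆ i, V i).compl = B := by
  refine SetLike.coe_injective ?_
  rw [Opens.coe_compl, Opens.coe_iSup, h.iUnion_eq, compl_compl]

theorem isDugundjiSystemFor (h : IsWhitneyCover B V y) (hV : LocallyFiniteInUnion V) :
    IsDugundjiSystemFor 1 B V y where
  nonempty := ⟨y 0, h.mem 0⟩
  locallyFinite := hV
  iUnion_eq := h.iUnion_eq
  mem := h.mem
  dist_le i x hx := by simpa only [one_add_one_eq_two] using h.dist_le i x hx
  small n hn := tendsto_of_tendsto_of_tendsto_of_le_of_le tendsto_const_nhds hn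
    (fun _ => zero_le) fun i => le_iInf₂ (h.ediam_le (n i))

theorem mem_dugundjiSystems (h : IsWhitneyCover B V y) (hV : LocallyFiniteInUnion V) :
    (V, y) ∈ DugundjiSystems X := by
  change IsDugundjiSystemFor 1 (⨆ i, V i).compl V y
  rw [h.compl_iSup_eq]
  exact h.isDugundjiSystemFor hV

theorem traceOpen (h : IsWhitneyCover B V y) (hBA : (B : Set X) ⊆ A) (hWV : ∀ i, W i ≤ V i)
    (hWA : (⋃ i, (W i : Set X)) ∩ (A : Set X) = (⋃ i, (V i : Set X)) ∩ (A : Set X)) :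
    IsWhitneyCover (B.preimage (continuous_subtype_val (p := (· ∈ (A : Set X)))))
      (fun i => traceOpen A (W i)) fun i => (⟨y i, hBA (h.mem i)⟩ : (A : Set X)) := by
  have himage : (Subtype.val '' (Subtype.val ⁻¹' (B : Set X) : Set (A : Set X))) = (B : Set X) := by
    rw [Subtype.image_preimage_coe, inter_eq_right.2 hBA]
  refine ⟨?_, h.mem, fun i x hx => ?_, fun i x hx => ?_⟩
  · ext x
    have hx := Set.ext_iff.1 hWA x.1
    rw [h.iUnion_eq] at hx
    simp only [mem_inter_iff, mem_iUnion, mem_compl_iff, x.2, and_true] at hx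
    exact mem_iUnion.trans hx
  · have hinf := Metric.infDist_image (x := x) (t := Subtype.val ⁻¹' (B : Set X))
      (isometry_subtype_coe (s := (A : Set X)))
    rw [himage] at hinf
    exact (h.dist_le i x (hWV i hx)).trans_eq (congrArg _ hinf)
  · have hinf := Metric.infEDist_image (x := x) (t := Subtype.val ⁻¹' (B : Set X))
      (isometry_subtype_coe (s := (A : Set X)))
    rw [himage] at hinf
    calc Metric.ediam (Subtype.val ⁻¹' (W i : Set X) : Set (A : Set X))
        = Metric.ediam (Subtype.val '' (Subtype.val ⁻¹' (W i : Set X) : Set (A : Set X))) :=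
          (isometry_subtype_coe.ediam_image _).symm
      _ ≤ Metric.ediam (V i : Set X) :=
          Metric.ediam_mono ((image_preimage_subset _ _).trans (hWV i))
      _ ≤ Metric.infEDist x.1 (B : Set X) := h.ediam_le i x (hWV i hx)
      _ = _ := hinf

theorem inf_compl_iSup_eq (h : IsWhitneyCover B V y) (hBA : (B : Set X) ⊆ A)
    (hWA : (⋃ i, (W i : Set X)) ∩ (A : Set X) = (⋃ i, (V i : Set X)) ∩ (A : Set X)) :
    A ⊓ (⨆ i, W i).compl = B := by
  refine SetLike.coe_injective ?_
  rw [Closeds.coe_inf, Opens.coe_compl, Opens.coe_iSup, ← sdiff_eq, ← sdiff_inter_self_eq_sdiff,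
    hWA, h.iUnion_eq, sdiff_inter_self_eq_sdiff, sdiff_compl, inter_eq_right.2 hBA]

theorem mem_relDugundjiSystems (h : IsWhitneyCover B V y) (hBA : (B : Set X) ⊆ A)
    (hWV : ∀ i, W i ≤ V i)
    (hWA : (⋃ i, (W i : Set X)) ∩ (A : Set X) = (⋃ i, (V i : Set X)) ∩ (A : Set X))
    (hW : ∀ i j, i ≠ j → (W i : Set X) ∩ (W j : Set X) = ∅) :
    (W, y) ∈ RelDugundjiSystems A := by
  refine ⟨fun i => hBA (h.mem i), (h.traceOpen hBA hWV hWA).mem_dugundjiSystems ?_⟩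
  refine .of_pairwiseDisjoint fun i j hij => ?_
  change Subtype.val ⁻¹' ((W i : Set X) ∩ (W j : Set X)) = ∅
  rw [hW i j hij, preimage_empty]

end IsWhitneyCover

end Metric

/-! ### Searching for admissible balls -/

/-- The test for admissibility of a ball of radius `nuQpos r`: `e` codes an approximation, with
precision `2 * 2⁻¹ ^ m`, of the distance of its centre from the point of `B`, and `v` is a value of
`etaApprox` for the distance function of `B`. A lower bound `nuQ c` shows up as `v = c + 2`,
because `lowerName` and `etaApprox` both add one. -/
def AcceptsBall (r e v m : ℕ) : Prop :=
  2 ≤ v ∧ 8 * nuQpos r < nuQ (v - 2) ∧ 2 * (nuQ e + 2 * 2⁻¹ ^ m) < 3 * nuQ (v - 2)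

instance (r e v m : ℕ) : Decidable (AcceptsBall r e v m) :=
  inferInstanceAs (Decidable (_ ∧ _ ∧ _))

theorem primrecPred_acceptsBall {r e v m : α → ℕ} (hr : Primrec r) (he : Primrec e)
    (hv : Primrec v) (hm : Primrec m) :
    PrimrecPred fun x => AcceptsBall (r x) (e x) (v x) (m x) := by
  have hlower : PrimrecRat fun x => nuQ (v x - 2) := .nuQ (Primrec.nat_sub.comp hv (.const 2))
  exact (Primrec.nat_le.comp (.const 2) hv).and <|
    (PrimrecRat.lt ((PrimrecRat.natCast 8).mul (.nuQpos hr)) hlower).and <|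
      PrimrecRat.lt ((PrimrecRat.natCast 2).mul
        ((PrimrecRat.nuQ he).add ((PrimrecRat.natCast 2).mul (.inv_two_pow hm))))
        ((PrimrecRat.natCast 3).mul hlower)

section Search

variable {X : Type*} [PseudoMetricSpace X] {B : Set X} {x b : X} {r : ℕ}

theorem AcceptsBall.isAdmissibleBall {e v m : ℕ} (h : AcceptsBall r e v m)
    (hv : ∀ c, v = c + 2 → nuQ c < Metric.infDist x B)
    (he : |dist x b - nuQ e| ≤ 2 * 2⁻¹ ^ m) : IsAdmissibleBall B x (nuQpos r) b := by
  obtain ⟨hle, hradius, hdist⟩ := h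
  have hlower := hv (v - 2) (Nat.sub_add_cancel hle).symm
  have hradius' : (8 * nuQpos r : ℝ) < nuQ (v - 2) := by exact_mod_cast hradius
  have hdist' : (2 * (nuQ e + 2 * 2⁻¹ ^ m) : ℝ) < 3 * nuQ (v - 2) := by
    rw [← Rat.cast_lt (K := ℝ)] at hdist
    push_cast at hdist
    exact hdist
  exact ⟨by linarith, by linarith [(abs_le.1 he).2]⟩

theorem IsAdmissibleBall.exists_eventually_acceptsBall (h : IsAdmissibleBall B x (nuQpos r) b)
    {e : ℕ → ℕ} (he : ∀ m, |dist x b - nuQ (e m)| ≤ 2 * 2⁻¹ ^ m) :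
    ∃ c, nuQ c < Metric.infDist x B ∧ ∀ᶠ m in atTop, AcceptsBall r (e m) (c + 2) m := by
  obtain ⟨q, hq, hqB⟩ := exists_rat_btwn (show max (8 * nuQpos r : ℝ) (2 / 3 * dist x b) <
    Metric.infDist x B from max_lt h.radius_lt (by linarith [h.dist_lt]))
  obtain ⟨c, rfl⟩ := nuQ_surjective q
  obtain ⟨hradius, hdist⟩ := max_lt_iff.1 hq
  have hzero : Tendsto (fun m : ℕ => (8 * 2⁻¹ ^ m : ℝ)) atTop (𝓝 0) := by
    simpa using (tendsto_pow_atTop_nhds_zero_of_lt_one (r := (2⁻¹ : ℝ)) (by norm_num)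
      (by norm_num)).const_mul 8
  refine ⟨c, hqB, ?_⟩
  filter_upwards [hzero.eventually_lt_const (show 0 < 3 * nuQ c - 2 * dist x b by linarith)]
    with m hm
  refine ⟨Nat.le_add_left _ _, by exact_mod_cast hradius, ?_⟩
  rw [Nat.add_sub_cancel, ← Rat.cast_lt (K := ℝ)]
  push_cast
  linarith [(abs_le.1 (he m)).1]

end Search

/-- Stage `i` of the search tests the `b`-th ideal ball and the `k`-th point of the dense sequence,
with the `n`-th lower bound for the distance and precision `m`, if
`searchStage i = (b, k, n, m)`. -/
@[irreducible] def searchStage (i : ℕ) : ℕ × ℕ × ℕ × ℕ := Denumerable.ofNat _ i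

/-- The index of the point of the dense sequence that is tested in stage `i` of the search. -/
def pointIndex (i : ℕ) : ℕ := (searchStage i).2.1

/-- The `α'`-code of the ball found in stage `i` of the search, which is `∅` if the test fails.
Here `f` approximates the distances, `p` is a `rangeName` and `q` is a `distName`. -/
def ballCode (f : ℕ × ℕ × ℕ → ℕ) (p q : ℕ → ℕ) (i : ℕ) : ℕ :=
  let (b, k, n, m) := searchStage i
  if AcceptsBall b.unpair.2 (f (b.unpair.1, component p k m - 1, m))
    (etaApprox q (fun _ => b.unpair.1) n m) m then b + 1 else 0

theorem searchStage_surjective : Function.Surjective searchStage :=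
  fun s => ⟨Encodable.encode s, by rw [searchStage, Denumerable.ofNat_encode]⟩

theorem primrec_searchStage : Primrec searchStage :=
  (Primrec.ofNat _).of_eq fun i => by rw [searchStage]

theorem primrec_pointIndex : Primrec pointIndex :=
  Primrec.fst.comp (Primrec.snd.comp primrec_searchStage)

theorem OracleComputableOn.ballCode {f : ℕ × ℕ × ℕ → ℕ} (hf : Computable f)
    {P Q : (ℕ → ℕ) → ℕ → ℕ} (hP : OracleComputableOn D P) (hQ : OracleComputableOn D Q) :
    OracleComputableOn D fun p => ballCode f (P p) (Q p) := by
  have hb : Primrec fun i => (searchStage i).1 := Primrec.fst.comp primrec_searchStage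
  have hknm : Primrec fun i => (searchStage i).2 := Primrec.snd.comp primrec_searchStage
  have hn : Primrec fun i => (searchStage i).2.2.1 := Primrec.fst.comp (Primrec.snd.comp hknm)
  have hm : Primrec fun i => (searchStage i).2.2.2 := Primrec.snd.comp (Primrec.snd.comp hknm)
  have hcenter : Primrec fun i => (searchStage i).1.unpair.1 :=
    Primrec.fst.comp (Primrec.unpair.comp hb)
  have hpoint : OracleComputableOn D fun p i =>
      DugundjiZD.component (P p) (pointIndex i) (searchStage i).2.2.2 - 1 :=
    (hP.component.comp_computable (primrec_pointIndex.pair hm).to_comp).map Primrec.pred.to_comp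
  have hdist : OracleComputableOn D fun p i => f ((searchStage i).1.unpair.1,
      DugundjiZD.component (P p) (pointIndex i) (searchStage i).2.2.2 - 1,
      (searchStage i).2.2.2) :=
    ((of_computable hcenter.to_comp).prodMk (hpoint.prodMk (of_computable hm.to_comp))).map hf
  have hlower : OracleComputableOn D fun p i => DugundjiZD.etaApprox (Q p)
      (fun _ => (searchStage i).1.unpair.1) (searchStage i).2.2.1 (searchStage i).2.2.2 :=
    (hQ.etaApprox (q := fun a _ => a) Computable.fst.to₂).comp_computable
      ((hcenter.pair hn).pair hm).to_comp
  have htest : Primrec fun x : ℕ × ℕ × ℕ => if AcceptsBall (searchStage x.1).1.unpair.2 x.2.1 x.2.2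
      (searchStage x.1).2.2.2 then (searchStage x.1).1 + 1 else 0 :=
    Primrec.ite (primrecPred_acceptsBall
      (Primrec.snd.comp (Primrec.unpair.comp (hb.comp Primrec.fst)))
      (Primrec.fst.comp Primrec.snd) (Primrec.snd.comp Primrec.snd) (hm.comp Primrec.fst))
      (Primrec.succ.comp (hb.comp Primrec.fst)) (Primrec.const 0)
  exact ((of_computable Computable.id).prodMk (hdist.prodMk hlower)).map htest.to_comp

section Metric

variable {X : Type*} [MetricSpace X] {ν b : ℕ → X} {B : Closeds X} {p q : ℕ → ℕ}
  {f : ℕ × ℕ × ℕ → ℕ}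

theorem isOpen_ballNumShift (ν : ℕ → X) : ∀ n, IsOpen (ballNumShift ν n)
  | 0 => isOpen_empty
  | _ + 1 => Metric.isOpen_ball

theorem isAdmissibleBall_of_mem_ballCode
    (hf : ApproximatesDist ν f)
    (hB : (B : Set X).Nonempty) (hq : distName ν q B)
    (hb : ∀ k, pointName ν (fun m => component p k m - 1) (b k)) {i : ℕ} {x : X}
    (hx : x ∈ ballNumShift ν (ballCode f p q i)) :
    ∃ z ρ, IsAdmissibleBall (B : Set X) z ρ (b (pointIndex i)) ∧
      ballNumShift ν (ballCode f p q i) = Metric.ball z ρ := by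
  obtain ⟨⟨c, k, n, m⟩, hi⟩ : ∃ s, searchStage i = s := ⟨_, rfl⟩
  simp only [ballCode, pointIndex, hi] at hx ⊢
  split_ifs at hx ⊢ with haccept
  · refine ⟨_, _, haccept.isAdmissibleBall (fun d hd => ?_)
      ((hb k).abs_dist_sub_nuQ_le hf c.unpair.1 m), rfl⟩
    obtain ⟨t, ht, hlower⟩ := hq.exists_etaValue hB c.unpair.1
    obtain ⟨m₀, hm₀⟩ := ht.exists_etaApprox_eq n
    refine (hlower d).2 ⟨n, ?_⟩
    have := (hm₀ m).symm.trans hd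
    split_ifs at this
    exact Nat.succ_injective this
  · exact hx.elim

theorem IsAdmissibleBall.exists_ballCode_eq
    (hf : ApproximatesDist ν f)
    (hB : (B : Set X).Nonempty) (hq : distName ν q B)
    (hb : ∀ k, pointName ν (fun m => component p k m - 1) (b k)) {a r k : ℕ}
    (h : IsAdmissibleBall (B : Set X) (ν a) (nuQpos r) (b k)) :
    ∃ i, ballCode f p q i = Nat.pair a r + 1 := by
  obtain ⟨t, ht, hlower⟩ := hq.exists_etaValue hB a
  obtain ⟨c, hc, haccept⟩ := h.exists_eventually_acceptsBall ((hb k).abs_dist_sub_nuQ_le hf a)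
  obtain ⟨n, hn⟩ := (hlower c).1 hc
  obtain ⟨m₀, hm₀⟩ := ht.exists_etaApprox_eq n
  obtain ⟨m, hm, hlt⟩ := (haccept.and (eventually_gt_atTop m₀)).exists
  obtain ⟨i, hi⟩ := searchStage_surjective (Nat.pair a r, k, n, m)
  refine ⟨i, ?_⟩
  simp only [ballCode, hi, Nat.unpair_pair, hm₀, if_neg hlt.not_ge, hn, if_pos hm]

/-- The ball found in stage `i` of the search. -/
def foundBall (ν : ℕ → X) (f : ℕ × ℕ × ℕ → ℕ) (p q : ℕ → ℕ) (i : ℕ) : Opens X :=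
  ⟨ballNumShift ν (ballCode f p q i), isOpen_ballNumShift ν _⟩

theorem isWhitneyCover_foundBall (hν : DenseRange ν)
    (hf : ApproximatesDist ν f)
    (hq : distName ν q B) (hbB : ∀ k, b k ∈ B) (hdense : (B : Set X) ⊆ closure (range b))
    (hb : ∀ k, pointName ν (fun m => component p k m - 1) (b k)) :
    IsWhitneyCover B (foundBall ν f p q) fun i => b (pointIndex i) := by
  have hB : (B : Set X).Nonempty := ⟨b 0, hbB 0⟩
  have hadmissible : ∀ i, ∀ x ∈ foundBall ν f p q i, ∃ z ρ,
      IsAdmissibleBall (B : Set X) z ρ (b (pointIndex i)) ∧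
        (foundBall ν f p q i : Set X) = Metric.ball z ρ :=
    fun i x hx => isAdmissibleBall_of_mem_ballCode hf hB hq hb hx
  refine ⟨Subset.antisymm (iUnion_subset fun i x hx => ?_) fun x hx => ?_, fun i => hbB _,
    fun i x hx => ?_, fun i x hx => ?_⟩
  · obtain ⟨z, ρ, h, hball⟩ := hadmissible i x hx
    exact h.notMem (hball ▸ hx)
  · obtain ⟨a, r, k, h, hxa⟩ := exists_isAdmissibleBall hν hbB hdense
      (by rwa [B.isClosed.closure_eq])
    obtain ⟨i, hi⟩ := h.exists_ballCode_eq hf hB hq hb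
    refine mem_iUnion.2 ⟨i, ?_⟩
    change x ∈ ballNumShift ν (ballCode f p q i)
    rwa [hi, ballNumShift, ballNum, Nat.unpair_pair]
  · obtain ⟨z, ρ, h, hball⟩ := hadmissible i x hx
    exact h.dist_le (hball ▸ hx)
  · obtain ⟨z, ρ, h, hball⟩ := hadmissible i x hx
    rw [hball]
    exact h.ediam_ball_le (hball ▸ hx)

end Metric

/-! ### The realizer -/

/-- For an `inputName` `p` of `(A, B)`, a name of `(V, A)` where `V` is the Whitney cover
`foundBall` of the complement of `B`. -/
def coverName (f : ℕ × ℕ × ℕ → ℕ) (p : ℕ → ℕ) : ℕ → ℕ :=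
  interleave (tuple fun i _ => ballCode f (evenPart (oddPart p)) (oddPart (oddPart p)) i)
    (evenPart p)

/-- The `outputName` of `(A; W, y)` for an `inputName` `p` of `(A, B)` and a name `t` of a disjoint
refinement `W` of the Whitney cover `foundBall`. As a ball listed in component `j` of `t` meets only
`W j`, the code `2 ^ j` of `{j}` witnesses local finiteness. -/
def systemName (p t : ℕ → ℕ) : ℕ → ℕ :=
  interleave (evenPart p) <| interleave t <|
    interleave (interleave t (interleave t fun i => 2 ^ i.unpair.1)) <|
      tuple fun i m => component (evenPart (oddPart p)) (pointIndex i) m - 1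

theorem OracleComputableOn.coverName {f : ℕ × ℕ × ℕ → ℕ} (hf : Computable f) :
    OracleComputableOn D fun p => coverName f p :=
  (tuple ((OracleComputableOn.ballCode hf oracle.oddPart.evenPart
    oracle.oddPart.oddPart).comp_computable Computable.fst)).interleave oracle.evenPart

theorem OracleComputableOn.systemName {T : (ℕ → ℕ) → ℕ → ℕ} (hT : OracleComputableOn D T) :
    OracleComputableOn D fun p => systemName p (T p) := by
  have hpoints : OracleComputableOn D fun p (x : ℕ × ℕ) =>
      DugundjiZD.component (DugundjiZD.evenPart (DugundjiZD.oddPart p)) (pointIndex x.1) x.2 - 1 :=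
    (oracle.oddPart.evenPart.component.comp_computable
      ((primrec_pointIndex.comp Primrec.fst).pair Primrec.snd).to_comp).map Primrec.pred.to_comp
  have hcodes : Computable fun i : ℕ => 2 ^ i.unpair.1 :=
    (primrec_two_pow.comp (Primrec.fst.comp Primrec.unpair)).to_comp
  exact oracle.evenPart.interleave <| hT.interleave <|
    (hT.interleave (hT.interleave (of_computable hcodes))).interleave hpoints.tuple

section Metric

variable {X : Type*} [MetricSpace X] {ν : ℕ → X} {A : Closeds X} {W : ℕ → Opens X}
  {𝒴 : Set (Closeds X)} {δY : Naming 𝒴} {p t : ℕ → ℕ}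

theorem prodName_coverName (f : ℕ × ℕ × ℕ → ℕ) {A : 𝒴} (hpA : δY (evenPart p) A) :
    prodName (seqName (openName ν)) δY (coverName f p)
      (foundBall ν f (evenPart (oddPart p)) (oddPart (oddPart p)), A) := by
  rw [prodName, coverName, evenPart_interleave, oddPart_interleave]
  refine ⟨fun i => ?_, hpA⟩
  rw [component_tuple]
  exact (iUnion_const _).symm

theorem openName.traceOpen {U : Opens X} (h : openName ν t U) (A : Closeds X) :
    openNameRel ν A t (traceOpen A U) := by
  change Subtype.val ⁻¹' (U : Set X) = _
  rw [h, preimage_iUnion]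
  rfl

theorem lfNameRel_of_pairwiseDisjoint (hW : seqName (openName ν) t W)
    (hdisj : ∀ i j, i ≠ j → (W i : Set X) ∩ (W j : Set X) = ∅) :
    lfNameRel ν A (interleave t (interleave t fun i => 2 ^ i.unpair.1))
      fun i => traceOpen A (W i) := by
  have htrace : seqName (openNameRel ν A) t fun i => traceOpen A (W i) :=
    fun j => (hW j).traceOpen A
  simp only [lfNameRel, evenPart_interleave, oddPart_interleave]
  refine ⟨htrace, ?_, fun i j => ?_⟩
  · calc ⋃ j, (traceOpen A (W j) : Set (A : Set X))
        = ⋃ (j) (k), ballNumRel ν A (t (Nat.pair j k)) := iUnion_congr htrace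
      _ = ⋃ i : ℕ, ballNumRel ν A (t (Nat.pair i.unpair.1 i.unpair.2)) :=
        (iUnion_unpair fun j k => ballNumRel ν A (t (Nat.pair j k))).symm
      _ = ⋃ i, ballNumRel ν A (t i) := by simp only [Nat.pair_unpair]
  · rintro ⟨x, hxW, hxt⟩
    have hx : x ∈ traceOpen A (W i.unpair.1) := by
      refine (htrace i.unpair.1).ge (mem_iUnion.2 ⟨i.unpair.2, ?_⟩)
      rwa [component, Nat.pair_unpair]
    obtain rfl : i.unpair.1 = j := by
      by_contra hij
      exact (hdisj _ _ hij).subset ⟨hx, hxW⟩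
    exact Nat.testBit_two_pow_self

theorem outputName_systemName {e : SystemsOver 𝒴} (hpA : δY (evenPart p) e.1.1)
    (hW : seqName (openName ν) t e.1.2.1)
    (hdisj : ∀ i j, i ≠ j → (e.1.2.1 i : Set X) ∩ (e.1.2.1 j : Set X) = ∅)
    (hy : ∀ i, pointName ν
      (fun m => component (evenPart (oddPart p)) (pointIndex i) m - 1) (e.1.2.2 i)) :
    outputName ν 𝒴 δY (systemName p t) e := by
  simp only [outputName, systemName, evenPart_interleave, oddPart_interleave]
  refine ⟨hpA, hW, lfNameRel_of_pairwiseDisjoint hW hdisj, fun i => ?_⟩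
  rw [component_tuple]
  exact hy i

theorem exists_outputName_systemName (hν : DenseRange ν) {f : ℕ × ℕ × ℕ → ℕ}
    (hf : ApproximatesDist ν f)
    {P : PairsOver 𝒴} (hp : inputName ν 𝒴 δY p P) (hWt : seqName (openName ν) t W)
    (hW : W ∈ disjointify 𝒴
      (foundBall ν f (evenPart (oddPart p)) (oddPart (oddPart p)), P.1.1)) :
    ∃ e ∈ disjointSystems 𝒴 P, outputName ν 𝒴 δY (systemName p t) e := by
  obtain ⟨⟨A, B⟩, hB, hBA⟩ := P
  obtain ⟨hpA, hrange, hdist⟩ := hp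
  obtain ⟨hWV, hWA, hdisj⟩ := hW
  obtain ⟨b, hbB, hdense, hb⟩ := hrange.exists_dense_points hB
  have hcover := isWhitneyCover_foundBall hν hf hdist hbB hdense hb
  exact ⟨⟨(A, W, fun i => b (pointIndex i)), hcover.mem_relDugundjiSystems hBA hWV hWA hdisj⟩,
    ⟨Prod.ext rfl (hcover.inf_compl_iSup_eq hBA hWA), hdisj⟩,
    outputName_systemName hpA hWt hdisj fun i => hb (pointIndex i)⟩

end Metric

end DugundjiZD

theorem mainTheorem6_general {X : Type*} [MetricSpace X] (ν : ℕ → X)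
    (hν : DugundjiZD.IsComputableMetricSpace ν)
    (𝒴 : Set (TopologicalSpace.Closeds X))
    (δY : DugundjiZD.Naming 𝒴)
    (hS : DugundjiZD.ComputableOperation
      (DugundjiZD.prodName (DugundjiZD.seqName (DugundjiZD.openName ν)) δY)
      (DugundjiZD.seqName (DugundjiZD.openName ν))
      Set.univ (DugundjiZD.disjointify 𝒴)) :
    DugundjiZD.ComputableOperation
      (DugundjiZD.inputName ν 𝒴 δY)
      (DugundjiZD.outputName ν 𝒴 δY)
      Set.univ (DugundjiZD.disjointSystems 𝒴) := by
  obtain ⟨f, hf, hfν⟩ := hν.dist_computable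
  obtain ⟨T, hT, hTS⟩ := DugundjiZD.computableOperation_iff_exists_realizer.1 hS
  refine DugundjiZD.computableOperation_iff_exists_realizer.2
    ⟨fun p => DugundjiZD.systemName p (T (DugundjiZD.coverName f p)), ?_, ?_⟩
  · refine (hT.subst (.coverName hf) ?_).systemName
    rintro p ⟨P, -, hpA, -⟩
    exact ⟨_, mem_univ _, DugundjiZD.prodName_coverName f hpA⟩
  · intro P _ p hp
    obtain ⟨W, hW, hWT⟩ := hTS _ (mem_univ _) _ (DugundjiZD.prodName_coverName f hp.1)
    exact DugundjiZD.exists_outputName_systemName hν.dense hfν hp hWT hW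

theorem mainTheorem6 {X : Type*} [MetricSpace X] (ν : ℕ → X)
    (hν : DugundjiZD.IsComputableMetricSpace ν)
    (𝒴 : Set (TopologicalSpace.Closeds X))
    (hne : ∀ A ∈ 𝒴, (A : Set X).Nonempty)
    (δY : DugundjiZD.Naming 𝒴)
    (hrep : DugundjiZD.IsRepresentation δY)
    (hle : DugundjiZD.ReducibleTo δY
      (DugundjiZD.restrictName (DugundjiZD.closedName ν) 𝒴))
    (hS : DugundjiZD.ComputableOperation
      (DugundjiZD.prodName (DugundjiZD.seqName (DugundjiZD.openName ν)) δY)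
      (DugundjiZD.seqName (DugundjiZD.openName ν))
      Set.univ (DugundjiZD.disjointify 𝒴)) :
    DugundjiZD.ComputableOperation
      (DugundjiZD.inputName ν 𝒴 δY)
      (DugundjiZD.outputName ν 𝒴 δY)
      {P | (P.1.2 : Set X) ≠ Set.univ} (DugundjiZD.disjointSystems 𝒴) :=
  (mainTheorem6_general ν hν 𝒴 δY hS).mono (subset_univ _)
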